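/- Let $\mathsf C=(\mathsf c_{i,j})_{i,j\in I}$ be the Cartan matrix of a finite-dimensional simple Lie algebra, $\mathsf c_{i,j}=\langle h_i,\alpha_j\rangle$, with (connected) Dynkin diagram $\triangle$, and let $(\ ,\ )$ be the invariant symmetric bilinear form on the root lattice normalized by $(\alpha,\alpha)=2$ for short roots $\alpha$. Put $d_i=(\alpha_i,\alpha_i)/2\in\mathbb Z_{>0}$, so that $(\alpha_i,\alpha_j)=d_i\mathsf c_{i,j}$, and let $d(i,j)$ be the distance between $i$ and $j$ in the graph $\triangle$. Let $\xi:I\to\mathbb Z$ be a height function, i.e. $|\xi_i-\xi_j|=1$ whenever $d(i,j)=1$, and put $\widehat\triangle_0=\{(i,p)\in I\times\mathbb Z: p-\xi_i\in 2\mathbb Z\}$. Let $\underline{\mathsf C}(t)$ be the matrix over $\mathbb Q(t)$ with diagonal entries $t+t^{-1}$ and off-diagonal entries $\mathsf c_{i,j}$, put $\underline{\mathsf B}(t)=\underline{\mathsf C}(t)\,\mathrm{diag}(d_i)^{-1}$, and let $\widetilde{\mathsf b}_{i,j}(u)$ be the coefficient of $t^u$ in the Laurent expansion at $t=0$ of $(\underline{\mathsf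 B}(t)^{-1})_{i,j}$; these coefficients are integers. Put $\eta_{i,j}(u)=\widetilde{\mathsf b}_{i,j}(u)+\widetilde{\mathsf b}_{i,j}(-u)$ and $\underline{\mathcal N}(i,p;j,s)=\eta_{i,j}(p-s-1)-\eta_{i,j}(p-s+1)$. Let $q$ be an indeterminate and let $\mathcal X_q$ be the $\mathbb Z[q^{\pm1/2}]$-algebra with generators $\widetilde X_{i,p}^{\pm1}$, $(i,p)\in\widehat\triangle_0$, and defining relations $\widetilde X_{i,p}\widetilde X_{i,p}^{-1}=\widetilde X_{i,p}^{-1}\widetilde X_{i,p}=1$ and $\widetilde X_{i,p}\widetilde X_{j,s}=q^{\underline{\mathcal N}(i,p;j,s)}\widetilde X_{j,s}\widetilde X_{i,p}$. Let the bar involution be the ring anti-involution of $\mathcal X_q$ with $q^{1/2}\mapsto q^{-1/2}$ and $\widetilde X_{i,p}\mapsto q^{d_i}\widetilde X_{i,p}$. For $(i,p+1)\in\widehat\triangle_0$ let $$\widetilde B_{i,p}=q^{n_{i,p}}\,\widetilde X_{i,p-1}\widetilde X_{i,p+1}\prod_{j:\,d(i,j)=1}\widetilde X_{j,p}^{\,\mathsf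 c_{j,i}},$$ where $n_{i,p}\in\tfrac12\mathbb Z$ is chosen so that $\widetilde B_{i,p}$ is fixed by the bar involution (the factors of the product over $j$ commute with one another). Then for all $i,j\in I$ and $p,s,t,u\in\mathbb Z$ with $(i,p),(j,s+1),(i,t+1),(j,u+1)\in\widehat\triangle_0$, respectively, $$\widetilde X_{i,p}\widetilde B_{j,s}^{-1}=q^{\beta(i,p;j,s)}\widetilde B_{j,s}^{-1}\widetilde X_{i,p},\qquad \widetilde B_{i,t}^{-1}\widetilde B_{j,u}^{-1}=q^{\alpha(i,t;j,u)}\widetilde B_{j,u}^{-1}\widetilde B_{i,t}^{-1},$$ where $$\beta(i,p;j,s)=\delta(i=j)\bigl(-\delta(p-s=1)+\delta(p-s=-1)\bigr)(\alpha_i,\alpha_i),$$ $$\alpha(i,t;j,u)=\begin{cases}\pm(\alpha_i,\alpha_i)&\text{if }(i,t)=(j,u\pm2),\\ \pm2(\alpha_i,\alpha_j)&\text{if }d(i,j)=1\text{ and }t=u\pm1,\\ 0&\text{otherwise.}\end{cases}$$ -/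

import Mathlib

noncomputable section

namespace QVirtual

open scoped LaurentPolynomial LaurentSeries RatFunc

/-- A finite Cartan datum of simple type: a Cartan matrix `C = (c_{ij})` of finite type with
connected Dynkin diagram, together with the half squared lengths `d_i = (α_i, α_i) / 2` of the
simple roots.  The symmetrized matrix `(d_i c_{ij})` is required to be symmetric and positive
definite (this is the Gram matrix of the invariant form in the basis of simple roots), and the form
is normalized by `(α, α) = 2` for short roots `α`, that is, the smallest `d_i` is `1`. -/
structure FiniteCartanDatum (I : Type*) [Fintype I] [DecidableEq I] where
  /-- The Cartan matrix, `C i j = ⟨h_i, α_j⟩`. -/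
  C : Matrix I I ℤ
  /-- The half squared lengths of the simple roots. -/
  d : I → ℤ
  diag : ∀ i, C i i = 2
  offDiag : ∀ i j, i ≠ j → C i j ≤ 0
  d_pos : ∀ i, 0 < d i
  short : ∃ i, d i = 1
  posDef : (Matrix.diagonal d * C).PosDef
  connected : (SimpleGraph.fromRel fun i j => C i j < 0).Connected

section Datum

variable {I : Type*} [Fintype I] [DecidableEq I] (D : FiniteCartanDatum I)

/-- The Dynkin diagram: vertices `I`, an edge between `i ≠ j` when `c_{ij} < 0`. -/
def FiniteCartanDatum.diagram : SimpleGraph I :=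
  SimpleGraph.fromRel fun i j => D.C i j < 0

/-- `d(i,j)`: the number of edges between `i` and `j` in the Dynkin diagram (graph distance). -/
def FiniteCartanDatum.dist (i j : I) : ℕ := D.diagram.dist i j

/-- The simple root `α_i` in the root lattice, the free abelian group on `I`. -/
def FiniteCartanDatum.root (_D : FiniteCartanDatum I) (i : I) : I → ℤ := Pi.single i 1

/-- The symmetric bilinear form `( , )` on the root lattice, with `(α_i, α_j) = d_i c_{ij}`. -/
def FiniteCartanDatum.form : LinearMap.BilinForm ℤ (I → ℤ) :=
  Matrix.toBilin' (Matrix.diagonal D.d * D.C)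

theorem FiniteCartanDatum.form_root (i j : I) :
    D.form (D.root i) (D.root j) = D.d i * D.C i j := by
  simp [FiniteCartanDatum.form, FiniteCartanDatum.root, Matrix.diagonal_mul]

theorem FiniteCartanDatum.form_root_self (i : I) :
    D.form (D.root i) (D.root i) = 2 * D.d i := by
  rw [D.form_root, D.diag, mul_comm]

/-- The `t`-quantized Cartan matrix `C(t)`, the value at `q = 1` of the `(q,t)`-Cartan matrix
`(q^{d_i} t⁻¹ + q^{-d_i} t) δ(i = j) - [-δ(i ≠ j) c_{ij}]_q`. -/
def FiniteCartanDatum.tCartan : Matrix I I (RatFunc ℚ) := fun i j =>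
  if i = j then RatFunc.X + (RatFunc.X)⁻¹ else (D.C i j : RatFunc ℚ)

/-- The matrix `B(t) = C(t) diag(d_i)⁻¹` over `ℚ(t)`. -/
def FiniteCartanDatum.tB : Matrix I I (RatFunc ℚ) :=
  D.tCartan * Matrix.diagonal fun i => ((D.d i : RatFunc ℚ))⁻¹

/-- The coefficient of `t^u` in the Laurent expansion at `t = 0` of the `(i,j)` entry
of `B(t)⁻¹`. -/
def FiniteCartanDatum.bCoeffRat (i j : I) (u : ℤ) : ℚ :=
  (algebraMap (RatFunc ℚ) ℚ⸨X⸩ (D.tB⁻¹ i j)).coeff u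

end Datum

section Datum

variable {I : Type*} [Fintype I] [DecidableEq I] (D : FiniteCartanDatum I)
open PowerSeries in
/-- `t C(t)` as a matrix of integral power series. -/
def FiniteCartanDatum.tCartanPow : Matrix I I ℤ⟦X⟧ := fun i j =>
  if i = j then 1 + PowerSeries.X ^ 2 else PowerSeries.C (D.C i j) * PowerSeries.X

open PowerSeries in
theorem FiniteCartanDatum.isUnit_det_tCartanPow : IsUnit D.tCartanPow.det := by
  rw [PowerSeries.isUnit_iff_constantCoeff, RingHom.map_det]
  have : (PowerSeries.constantCoeff (R := ℤ)).mapMatrix D.tCartanPow = 1 := by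
    ext i j
    by_cases h : i = j
    · subst h; simp [FiniteCartanDatum.tCartanPow]
    · simp [FiniteCartanDatum.tCartanPow, h]
  rw [this]; simp

/-- The base change `ℤ⟦t⟧ → ℚ((t))`. -/
def intToLaurent : PowerSeries ℤ →+* ℚ⸨X⸩ :=
  (HahnSeries.ofPowerSeries ℤ ℚ).comp (PowerSeries.map (Int.castRingHom ℚ))

theorem intToLaurent_coeff (f : PowerSeries ℤ) (u : ℤ) :
    ∃ n : ℤ, (n : ℚ) = (intToLaurent f).coeff u := by
  rcases Int.lt_or_le u 0 with hu | hu
  · refine ⟨0, ?_⟩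
    rw [intToLaurent, RingHom.comp_apply, HahnSeries.ofPowerSeries_apply,
      HahnSeries.embDomain_of_notMem_range]
    · simp
    · rintro ⟨n, hn⟩
      have : (n : ℤ) = u := hn
      omega
  · lift u to ℕ using hu
    refine ⟨PowerSeries.coeff u f, ?_⟩
    rw [intToLaurent, RingHom.comp_apply, HahnSeries.ofPowerSeries_apply_coeff]
    simp

theorem FiniteCartanDatum.map_tB_inv :
    (algebraMap (RatFunc ℚ) ℚ⸨X⸩).mapMatrix D.tB⁻¹ =
      intToLaurent.mapMatrix ((PowerSeries.X : PowerSeries ℤ) • (Matrix.diagonal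
        (fun i => (PowerSeries.C (D.d i) : PowerSeries ℤ)) * D.tCartanPow⁻¹)) := by
  have hd : ∀ i, ((D.d i : ℤ) : ℚ⸨X⸩) ≠ 0 := fun i => by
    have h : ((D.d i : ℤ) : ℚ) ≠ 0 := by exact_mod_cast (D.d_pos i).ne'
    have h2 := (map_ne_zero (algebraMap ℚ ℚ⸨X⸩)).2 h
    simpa using h2
  have hX : intToLaurent PowerSeries.X = (HahnSeries.single 1 1 : ℚ⸨X⸩) := by
    simp [intToLaurent]
  have hX0 : (HahnSeries.single 1 1 : ℚ⸨X⸩) ≠ 0 := by simp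
  have hcast : ∀ n : ℤ, intToLaurent (PowerSeries.C n) = (n : ℚ⸨X⸩) := fun n => by
    rw [← map_intCast intToLaurent n, ← map_intCast (PowerSeries.C (R := ℤ)) n]; simp
  have hC : intToLaurent.mapMatrix D.tCartanPow =
      (HahnSeries.single 1 1 : ℚ⸨X⸩) • (algebraMap (RatFunc ℚ) ℚ⸨X⸩).mapMatrix D.tCartan := by
    ext1 i j
    by_cases h : i = j
    · subst h
      simp only [RingHom.mapMatrix_apply, Matrix.map_apply, FiniteCartanDatum.tCartanPow,
        FiniteCartanDatum.tCartan, if_true, map_add, map_one, map_pow, hX, Matrix.smul_apply,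
        map_inv₀, RatFunc.coe_X, smul_eq_mul]
      rw [mul_add, mul_inv_cancel₀ hX0]; ring
    · simp only [RingHom.mapMatrix_apply, Matrix.map_apply, FiniteCartanDatum.tCartanPow,
        FiniteCartanDatum.tCartan, if_neg h, map_mul, hX, Matrix.smul_apply, map_intCast,
        smul_eq_mul, hcast]
      ring
  have hmul : intToLaurent.mapMatrix ((PowerSeries.X : PowerSeries ℤ) • (Matrix.diagonal
        (fun i => (PowerSeries.C (D.d i) : PowerSeries ℤ)) * D.tCartanPow⁻¹)) *
      (algebraMap (RatFunc ℚ) ℚ⸨X⸩).mapMatrix D.tB = 1 := by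
    have e1 : intToLaurent.mapMatrix ((PowerSeries.X : PowerSeries ℤ) • (Matrix.diagonal
        (fun i => (PowerSeries.C (D.d i) : PowerSeries ℤ)) * D.tCartanPow⁻¹)) =
        (HahnSeries.single 1 1 : ℚ⸨X⸩) • (Matrix.diagonal (fun i => ((D.d i : ℤ) : ℚ⸨X⸩)) *
          intToLaurent.mapMatrix D.tCartanPow⁻¹) := by
      ext1 i j
      simp only [RingHom.mapMatrix_apply, Matrix.map_apply, Matrix.smul_apply,
        Matrix.diagonal_mul, smul_eq_mul, map_mul, hX, hcast]
    have e2 : (algebraMap (RatFunc ℚ) ℚ⸨X⸩).mapMatrix D.tB =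
        (algebraMap (RatFunc ℚ) ℚ⸨X⸩).mapMatrix D.tCartan *
          Matrix.diagonal (fun i => ((D.d i : ℤ) : ℚ⸨X⸩)⁻¹) := by
      ext1 i j
      rw [RingHom.mapMatrix_apply, Matrix.map_apply, FiniteCartanDatum.tB, Matrix.mul_diagonal,
        Matrix.mul_diagonal, map_mul, map_inv₀, map_intCast, RingHom.mapMatrix_apply,
        Matrix.map_apply]
    have e3 : intToLaurent.mapMatrix D.tCartanPow⁻¹ * intToLaurent.mapMatrix D.tCartanPow = 1 := by
      rw [← map_mul, Matrix.nonsing_inv_mul _ D.isUnit_det_tCartanPow, map_one]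
    rw [hC] at e3
    rw [Matrix.mul_smul] at e3
    rw [e1, e2, Matrix.smul_mul, Matrix.mul_assoc, ← Matrix.mul_smul,
      ← Matrix.mul_assoc (intToLaurent.mapMatrix _), ← Matrix.smul_mul, e3, Matrix.one_mul,
      Matrix.diagonal_mul_diagonal]
    simp [hd]
  have hdet : IsUnit D.tB.det := by
    rw [isUnit_iff_ne_zero]
    intro h0
    have h1 := congrArg Matrix.det hmul
    rw [Matrix.det_mul, ← RingHom.map_det, ← RingHom.map_det, h0] at h1
    simp at h1
  have hinv : (algebraMap (RatFunc ℚ) ℚ⸨X⸩).mapMatrix D.tB *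
      (algebraMap (RatFunc ℚ) ℚ⸨X⸩).mapMatrix D.tB⁻¹ = 1 := by
    rw [← map_mul, Matrix.mul_nonsing_inv _ hdet, map_one]
  exact (left_inv_eq_right_inv hmul hinv).symm

/-- The Laurent coefficients of `B(t)⁻¹` are integers. -/
theorem FiniteCartanDatum.exists_int_bCoeff (i j : I) (u : ℤ) :
    ∃ n : ℤ, (n : ℚ) = D.bCoeffRat i j u := by
  have h := congrFun (congrFun D.map_tB_inv i) j
  simp only [RingHom.mapMatrix_apply, Matrix.map_apply] at h
  rw [FiniteCartanDatum.bCoeffRat, h]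
  exact intToLaurent_coeff _ u

/-- The integer `b_{ij}(u)` equal to the coefficient of `t^u` in `(B(t)⁻¹)_{ij}`. -/
def FiniteCartanDatum.bCoeff (i j : I) (u : ℤ) : ℤ := (D.exists_int_bCoeff i j u).choose

theorem FiniteCartanDatum.cast_bCoeff (i j : I) (u : ℤ) :
    (D.bCoeff i j u : ℚ) = D.bCoeffRat i j u := (D.exists_int_bCoeff i j u).choose_spec

/-- The even function `η_{ij}(u) = b_{ij}(u) + b_{ij}(-u)`. -/
def FiniteCartanDatum.eta (i j : I) (u : ℤ) : ℤ := D.bCoeff i j u + D.bCoeff i j (-u)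

/-- `N(i,p;j,s) = η_{ij}(p - s - 1) - η_{ij}(p - s + 1)`. -/
def FiniteCartanDatum.N (v w : I × ℤ) : ℤ :=
  D.eta v.1 w.1 (v.2 - w.2 - 1) - D.eta v.1 w.1 (v.2 - w.2 + 1)

theorem FiniteCartanDatum.N_same_level (i j : I) (p : ℤ) : D.N (i, p) (j, p) = 0 := by
  simp [FiniteCartanDatum.N, FiniteCartanDatum.eta, add_comm]

end Datum

/-- A Dynkin quiver `(△, ξ)`: a Dynkin diagram with a height function. -/
structure DynkinQuiver {I : Type*} [Fintype I] [DecidableEq I] (D : FiniteCartanDatum I) where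
  /-- The height function. -/
  ξ : I → ℤ
  height : ∀ i j, D.dist i j = 1 → |ξ i - ξ j| = 1

section Torus

variable {I : Type*} [Fintype I] [DecidableEq I] {D : FiniteCartanDatum I} (Q : DynkinQuiver D)

/-- The vertices of the repetition quiver: the pairs `(i,p)` with `p - ξ_i ∈ 2ℤ`. -/
def DynkinQuiver.vertices : Set (I × ℤ) := {v | Even (v.2 - Q.ξ v.1)}

theorem DynkinQuiver.mem_vertices (i : I) (p : ℤ) : (i, p) ∈ Q.vertices ↔ Even (p - Q.ξ i) :=
  Iff.rfl

theorem DynkinQuiver.mem_sub_one {i : I} {p : ℤ} (h : (i, p + 1) ∈ Q.vertices) :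
    (i, p - 1) ∈ Q.vertices := by
  rw [Q.mem_vertices] at *
  obtain ⟨k, hk⟩ := h
  exact ⟨k - 1, by omega⟩

theorem DynkinQuiver.mem_adj {i j : I} {p : ℤ} (h : (i, p + 1) ∈ Q.vertices)
    (hij : D.dist i j = 1) : (j, p) ∈ Q.vertices := by
  rw [Q.mem_vertices] at *
  obtain ⟨k, hk⟩ := h
  have h1 := Q.height i j hij
  rcases abs_eq (zero_le_one' ℤ) |>.1 h1 with h2 | h2
  · exact ⟨k, by omega⟩
  · exact ⟨k - 1, by omega⟩

/-- The ring `ℤ[q^{±1/2}]`: Laurent polynomials over `ℤ` in the variable `T 1 = q^{1/2}`. -/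
abbrev QRing : Type := ℤ[T;T⁻¹]

/-- `q^n = (q^{1/2})^{2n}` for an integer `n`. -/
def qPow (n : ℤ) : QRing := LaurentPolynomial.T (2 * n)

/-- The defining relations of the quantum torus, between elements of the free
`ℤ[q^{±1/2}]`-algebra on symbols `X_{i,p}` (`Sum.inl (i,p)`) and `X_{i,p}⁻¹` (`Sum.inr (i,p)`). -/
inductive DynkinQuiver.TorusRel :
    FreeAlgebra QRing (Q.vertices ⊕ Q.vertices) → FreeAlgebra QRing (Q.vertices ⊕ Q.vertices) → Prop
  | mul_inv (v : Q.vertices) : DynkinQuiver.TorusRel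
      (FreeAlgebra.ι QRing (Sum.inl v) * FreeAlgebra.ι QRing (Sum.inr v)) 1
  | inv_mul (v : Q.vertices) : DynkinQuiver.TorusRel
      (FreeAlgebra.ι QRing (Sum.inr v) * FreeAlgebra.ι QRing (Sum.inl v)) 1
  | comm (v w : Q.vertices) : DynkinQuiver.TorusRel
      (FreeAlgebra.ι QRing (Sum.inl v) * FreeAlgebra.ι QRing (Sum.inl w))
      (qPow (D.N v w) • (FreeAlgebra.ι QRing (Sum.inl w) * FreeAlgebra.ι QRing (Sum.inl v)))

/-- The quantum torus `𝒳_q`. -/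
def DynkinQuiver.Torus : Type _ := RingQuot Q.TorusRel

instance : Ring Q.Torus := inferInstanceAs (Ring (RingQuot Q.TorusRel))

instance : Algebra QRing Q.Torus := inferInstanceAs (Algebra QRing (RingQuot Q.TorusRel))

/-- The projection from the free algebra to the quantum torus. -/
def DynkinQuiver.torusMk : FreeAlgebra QRing (Q.vertices ⊕ Q.vertices) →ₐ[QRing] Q.Torus :=
  RingQuot.mkAlgHom QRing Q.TorusRel

/-- The generator `X_{i,p}`, as an invertible element of `𝒳_q`. -/
def DynkinQuiver.X (v : Q.vertices) : Q.Torusˣ where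
  val := Q.torusMk (FreeAlgebra.ι QRing (Sum.inl v))
  inv := Q.torusMk (FreeAlgebra.ι QRing (Sum.inr v))
  val_inv := by
    rw [← map_mul, ← map_one Q.torusMk]
    exact RingQuot.mkAlgHom_rel QRing (DynkinQuiver.TorusRel.mul_inv v)
  inv_val := by
    rw [← map_mul, ← map_one Q.torusMk]
    exact RingQuot.mkAlgHom_rel QRing (DynkinQuiver.TorusRel.inv_mul v)

theorem DynkinQuiver.X_mul_X (v w : Q.vertices) :
    (Q.X v * Q.X w : Q.Torus) = qPow (D.N v w) • (Q.X w * Q.X v : Q.Torus) := by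
  have h := RingQuot.mkAlgHom_rel QRing (DynkinQuiver.TorusRel.comm v w)
  rw [map_mul, map_smul, map_mul] at h
  exact h

/-- The central unit `q^{n/2}` of `𝒳_q`. -/
def DynkinQuiver.qHalf (n : ℤ) : Q.Torusˣ :=
  Units.map (algebraMap QRing Q.Torus).toMonoidHom
    ⟨LaurentPolynomial.T n, LaurentPolynomial.T (-n),
      by rw [← LaurentPolynomial.T_add]; simp, by rw [← LaurentPolynomial.T_add]; simp⟩

theorem DynkinQuiver.coe_qHalf (n : ℤ) :
    (Q.qHalf n : Q.Torus) = algebraMap QRing Q.Torus (LaurentPolynomial.T n) := rfl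

theorem DynkinQuiver.qHalf_zero : Q.qHalf 0 = 1 := by
  ext; rw [Q.coe_qHalf]; simp

theorem DynkinQuiver.qHalf_add (m n : ℤ) : Q.qHalf (m + n) = Q.qHalf m * Q.qHalf n := by
  ext; rw [Units.val_mul]; simp only [Q.coe_qHalf]; rw [LaurentPolynomial.T_add, map_mul]

theorem DynkinQuiver.qHalf_neg (n : ℤ) : Q.qHalf (-n) = (Q.qHalf n)⁻¹ :=
  eq_inv_of_mul_eq_one_left (by rw [← Q.qHalf_add, neg_add_cancel, Q.qHalf_zero])

theorem DynkinQuiver.qHalf_comm (n : ℤ) (x : Q.Torusˣ) : Q.qHalf n * x = x * Q.qHalf n := by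
  ext; exact Algebra.commutes _ _

theorem DynkinQuiver.X_mul_X' (v w : Q.vertices) :
    Q.X v * Q.X w = Q.qHalf (2 * D.N v w) * (Q.X w * Q.X v) := by
  ext
  rw [Units.val_mul, Q.X_mul_X, Algebra.smul_def]
  rfl

theorem DynkinQuiver.commute_same_level (i j : I) (p : ℤ) (hi : (i, p) ∈ Q.vertices)
    (hj : (j, p) ∈ Q.vertices) : Commute (Q.X ⟨(i, p), hi⟩) (Q.X ⟨(j, p), hj⟩) := by
  have h := Q.X_mul_X' ⟨(i, p), hi⟩ ⟨(j, p), hj⟩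
  rw [D.N_same_level, mul_zero, Q.qHalf_zero, one_mul] at h
  exact h

/-! The bar involution: the ring anti-involution of `𝒳_q` with `q^{1/2} ↦ q^{-1/2}` and
`X_{i,p} ↦ q^{d_i} X_{i,p}`. -/

/-- The opposite ring of `𝒳_q`, on which `q^{1/2}` acts as `q^{-1/2}`. -/
def DynkinQuiver.BarTarget : Type _ := Q.Torusᵐᵒᵖ

instance : Ring Q.BarTarget := inferInstanceAs (Ring Q.Torusᵐᵒᵖ)

instance : Algebra QRing Q.BarTarget :=
  RingHom.toAlgebra' (((algebraMap QRing Q.Torusᵐᵒᵖ).comp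
    (LaurentPolynomial.invert (R := ℤ)).toRingEquiv.toRingHom : QRing →+* Q.Torusᵐᵒᵖ))
    (fun c x => Algebra.commutes (A := Q.Torusᵐᵒᵖ) (LaurentPolynomial.invert c) x)

/-- The identity map of `𝒳_q`, seen as a map to `BarTarget`. -/
def DynkinQuiver.toBar (x : Q.Torus) : Q.BarTarget := (MulOpposite.op x : Q.Torusᵐᵒᵖ)

theorem DynkinQuiver.toBar_mul (x y : Q.Torus) : Q.toBar x * Q.toBar y = Q.toBar (y * x) := rfl

theorem DynkinQuiver.toBar_one : Q.toBar 1 = 1 := rfl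

theorem DynkinQuiver.smul_toBar (c : QRing) (x : Q.Torus) :
    c • Q.toBar x = Q.toBar (LaurentPolynomial.invert c • x) := by
  rw [Algebra.smul_def, Algebra.smul_def, Algebra.commutes]
  rfl

/-- The images of the generators under the bar involution. -/
def DynkinQuiver.barGen : Q.vertices ⊕ Q.vertices → Q.BarTarget
  | Sum.inl v => Q.toBar ((Q.qHalf (2 * D.d v.1.1) * Q.X v : Q.Torusˣ) : Q.Torus)
  | Sum.inr v => Q.toBar (((Q.qHalf (2 * D.d v.1.1) * Q.X v)⁻¹ : Q.Torusˣ) : Q.Torus)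

theorem DynkinQuiver.qHalf_mul_mul_qHalf_mul (a b : ℤ) (x y : Q.Torusˣ) :
    (Q.qHalf a * x) * (Q.qHalf b * y) = Q.qHalf (a + b) * (x * y) := by
  rw [mul_assoc, ← mul_assoc x, ← Q.qHalf_comm b x, Q.qHalf_add, mul_assoc, mul_assoc]

theorem DynkinQuiver.barGen_rel {x y : FreeAlgebra QRing (Q.vertices ⊕ Q.vertices)}
    (h : Q.TorusRel x y) :
    FreeAlgebra.lift QRing Q.barGen x = FreeAlgebra.lift QRing Q.barGen y := by
  induction h with
  | mul_inv v =>
    rw [map_mul, map_one, FreeAlgebra.lift_ι_apply, FreeAlgebra.lift_ι_apply, barGen, barGen,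
      toBar_mul, Units.inv_mul, toBar_one]
  | inv_mul v =>
    rw [map_mul, map_one, FreeAlgebra.lift_ι_apply, FreeAlgebra.lift_ι_apply, barGen, barGen,
      toBar_mul, Units.mul_inv, toBar_one]
  | comm v w =>
    rw [map_smul, map_mul, map_mul, FreeAlgebra.lift_ι_apply, FreeAlgebra.lift_ι_apply, barGen,
      barGen, toBar_mul, toBar_mul, smul_toBar, qPow, LaurentPolynomial.invert_T,
      Algebra.smul_def, ← Q.coe_qHalf, ← Units.val_mul, ← Units.val_mul, ← Units.val_mul,
      Q.qHalf_mul_mul_qHalf_mul, Q.qHalf_mul_mul_qHalf_mul, Q.X_mul_X' v w, ← mul_assoc,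
      ← mul_assoc, ← mul_assoc, ← mul_assoc, ← Q.qHalf_add, ← Q.qHalf_add]
    congr 5
    ring

/-- The bar involution as a ring homomorphism from `𝒳_q` to its opposite ring. -/
def DynkinQuiver.barHom : Q.Torus →+* Q.Torusᵐᵒᵖ :=
  (RingQuot.liftAlgHom QRing (s := Q.TorusRel) ⟨FreeAlgebra.lift QRing Q.barGen,
    fun _ _ h => Q.barGen_rel h⟩ : RingQuot Q.TorusRel →ₐ[QRing] Q.BarTarget).toRingHom

/-- The bar involution of `𝒳_q`. -/
def DynkinQuiver.bar (x : Q.Torus) : Q.Torus := (Q.barHom x).unop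

theorem DynkinQuiver.bar_add (x y : Q.Torus) : Q.bar (x + y) = Q.bar x + Q.bar y := by
  simp [DynkinQuiver.bar]

theorem DynkinQuiver.bar_one : Q.bar 1 = 1 := by
  simp [DynkinQuiver.bar]

theorem DynkinQuiver.bar_mul (x y : Q.Torus) : Q.bar (x * y) = Q.bar y * Q.bar x := by
  simp [DynkinQuiver.bar]

theorem DynkinQuiver.bar_algebraMap (c : QRing) :
    Q.bar (algebraMap QRing Q.Torus c) =
      algebraMap QRing Q.Torus (LaurentPolynomial.invert c) := by
  have h : Q.barHom (algebraMap QRing Q.Torus c) =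
      (algebraMap QRing Q.BarTarget c : Q.BarTarget) :=
    AlgHom.commutes (RingQuot.liftAlgHom QRing (s := Q.TorusRel) ⟨FreeAlgebra.lift QRing Q.barGen,
      fun _ _ h => Q.barGen_rel h⟩ : RingQuot Q.TorusRel →ₐ[QRing] Q.BarTarget) c
  rw [DynkinQuiver.bar, h]
  rfl

theorem DynkinQuiver.bar_X (v : Q.vertices) :
    Q.bar (Q.X v) = qPow (D.d v.1.1) • (Q.X v : Q.Torus) := by
  have h : Q.barHom (Q.X v) = (Q.barGen (Sum.inl v) : Q.BarTarget) :=
    (RingQuot.liftAlgHom_mkAlgHom_apply QRing (FreeAlgebra.lift QRing Q.barGen)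
      (fun _ _ h => Q.barGen_rel h) _).trans (FreeAlgebra.lift_ι_apply _ _)
  rw [DynkinQuiver.bar, h, Algebra.smul_def]
  rfl

/-- The `𝒳_q`-monomials: products of the elements `X_{i,p}^{±1}` and `q^{±1/2}`. -/
def DynkinQuiver.monomials : Subgroup Q.Torusˣ :=
  Subgroup.closure (insert (Q.qHalf 1) (Set.range Q.X))

theorem DynkinQuiver.monomial_comm {m m' : Q.Torusˣ} (hm : m ∈ Q.monomials)
    (hm' : m' ∈ Q.monomials) : ∃ k : ℤ, m * m' = Q.qHalf (2 * k) * (m' * m) := by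
  induction hm, hm' using Subgroup.closure_induction₂ with
  | mem x y hx hy =>
    rcases hx with rfl | ⟨v, rfl⟩
    · exact ⟨0, by rw [mul_zero, Q.qHalf_zero, one_mul, Q.qHalf_comm]⟩
    rcases hy with rfl | ⟨w, rfl⟩
    · exact ⟨0, by rw [mul_zero, Q.qHalf_zero, one_mul, Q.qHalf_comm]⟩
    · exact ⟨_, Q.X_mul_X' v w⟩
  | one_left x _ => exact ⟨0, by simp [Q.qHalf_zero]⟩
  | one_right x _ => exact ⟨0, by simp [Q.qHalf_zero]⟩
  | mul_left x y z _ _ _ h1 h2 =>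
    obtain ⟨a, ha⟩ := h1
    obtain ⟨b, hb⟩ := h2
    refine ⟨a + b, ?_⟩
    rw [mul_assoc x, hb, ← mul_assoc x, ← Q.qHalf_comm, mul_assoc, ← mul_assoc x, ha, mul_add,
      add_comm, Q.qHalf_add]
    simp only [mul_assoc]
  | mul_right x y z _ _ _ h1 h2 =>
    obtain ⟨a, ha⟩ := h1
    obtain ⟨b, hb⟩ := h2
    refine ⟨a + b, ?_⟩
    rw [← mul_assoc, ha, mul_assoc, mul_assoc x, hb, ← mul_assoc x, ← Q.qHalf_comm, mul_add,
      Q.qHalf_add]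
    simp only [mul_assoc]
  | inv_left x y _ _ h =>
    obtain ⟨a, ha⟩ := h
    refine ⟨-a, ?_⟩
    rw [inv_mul_eq_iff_eq_mul, mul_neg, Q.qHalf_neg, ← mul_assoc, ← mul_assoc, eq_mul_inv_iff_mul_eq,
      ← Q.qHalf_neg, ← Q.qHalf_comm, Q.qHalf_neg, mul_assoc, ha, inv_mul_cancel_left]
  | inv_right x y _ _ h =>
    obtain ⟨a, ha⟩ := h
    refine ⟨-a, ?_⟩
    rw [mul_neg, Q.qHalf_neg, eq_inv_mul_iff_mul_eq, eq_inv_mul_iff_mul_eq, ← mul_assoc, ← mul_assoc,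
      ← Q.qHalf_comm, mul_assoc (Q.qHalf _), ← ha, mul_inv_cancel_right]

/-- Every monomial is multiplied by a power of `q` under the bar involution. -/
theorem DynkinQuiver.bar_monomial {m : Q.Torusˣ} (hm : m ∈ Q.monomials) :
    ∃ k : ℤ, Q.bar m = (Q.qHalf (2 * k) * m : Q.Torusˣ) := by
  induction hm using Subgroup.closure_induction with
  | mem x hx =>
    rcases hx with rfl | ⟨v, rfl⟩
    · refine ⟨-1, ?_⟩
      rw [← Q.qHalf_add, Q.coe_qHalf, Q.bar_algebraMap, LaurentPolynomial.invert_T, Q.coe_qHalf]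
      norm_num
    · refine ⟨D.d v.1.1, ?_⟩
      rw [Q.bar_X, Algebra.smul_def, Units.val_mul, Q.coe_qHalf, qPow]
  | one => exact ⟨0, by simp [Q.bar_one, Q.qHalf_zero]⟩
  | mul x y hx hy h1 h2 =>
    obtain ⟨a, ha⟩ := h1
    obtain ⟨b, hb⟩ := h2
    obtain ⟨c, hc⟩ := Q.monomial_comm hy hx
    refine ⟨b + a + c, ?_⟩
    rw [Units.val_mul, Q.bar_mul, ha, hb, ← Units.val_mul, Q.qHalf_mul_mul_qHalf_mul, hc,
      ← mul_assoc, ← Q.qHalf_add]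
    congr 3
    ring
  | inv x hx h1 =>
    obtain ⟨a, ha⟩ := h1
    refine ⟨-a, ?_⟩
    have h2 : Q.bar (x⁻¹ : Q.Torusˣ) * Q.bar x = 1 := by
      rw [← Q.bar_mul, Units.mul_inv, Q.bar_one]
    rw [ha] at h2
    rw [Units.mul_eq_one_iff_eq_inv.1 h2, mul_inv_rev, ← Q.qHalf_neg, ← Q.qHalf_comm, mul_neg]

/-- Every monomial has a bar-invariant multiple by a power of `q^{1/2}`. -/
theorem DynkinQuiver.exists_barInvariant {m : Q.Torusˣ} (hm : m ∈ Q.monomials) :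
    ∃ n : ℤ, Q.bar (Q.qHalf n * m : Q.Torusˣ) = (Q.qHalf n * m : Q.Torusˣ) := by
  obtain ⟨k, hk⟩ := Q.bar_monomial hm
  refine ⟨k, ?_⟩
  rw [Units.val_mul, Q.bar_mul, hk, Q.coe_qHalf, Q.bar_algebraMap, LaurentPolynomial.invert_T,
    ← Q.coe_qHalf, ← Units.val_mul, ← Q.qHalf_comm, ← mul_assoc, ← Q.qHalf_add, ← Q.coe_qHalf,
    ← Units.val_mul]
  congr 3
  ring

/-- The monomial `X_{i,p-1} X_{i,p+1} ∏_{j : d(i,j) = 1} X_{j,p}^{c_{ji}}`. -/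
def DynkinQuiver.preB (i : I) (p : ℤ) (h : (i, p + 1) ∈ Q.vertices) : Q.Torusˣ :=
  open Classical in
  Q.X ⟨(i, p - 1), Q.mem_sub_one h⟩ * Q.X ⟨(i, p + 1), h⟩ *
    Finset.univ.noncommProd
      (fun j : {j : I // D.dist i j = 1} => Q.X ⟨(j.1, p), Q.mem_adj h j.2⟩ ^ D.C j.1 i)
      (fun _ _ _ _ _ => (Q.commute_same_level _ _ _ _ _).zpow_zpow _ _)

theorem DynkinQuiver.X_mem_monomials (v : Q.vertices) : Q.X v ∈ Q.monomials :=
  Subgroup.subset_closure (Or.inr ⟨v, rfl⟩)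

theorem DynkinQuiver.preB_mem (i : I) (p : ℤ) (h : (i, p + 1) ∈ Q.vertices) :
    Q.preB i p h ∈ Q.monomials := by
  refine mul_mem (mul_mem (Q.X_mem_monomials _) (Q.X_mem_monomials _)) ?_
  exact Subgroup.noncommProd_mem _ _ fun j _ => zpow_mem (Q.X_mem_monomials _) _

/-- The bar-invariant monomial `B_{i,p} = q^{n_{i,p}} X_{i,p-1} X_{i,p+1} ∏_j X_{j,p}^{c_{ji}}`, where
`n_{i,p}` in `½ℤ` is chosen so that `B_{i,p}` is fixed by the bar involution. -/
def DynkinQuiver.B (i : I) (p : ℤ) (h : (i, p + 1) ∈ Q.vertices) : Q.Torusˣ :=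
  Q.qHalf (Q.exists_barInvariant (Q.preB_mem i p h)).choose * Q.preB i p h

theorem DynkinQuiver.bar_B (i : I) (p : ℤ) (h : (i, p + 1) ∈ Q.vertices) :
    Q.bar (Q.B i p h) = Q.B i p h :=
  (Q.exists_barInvariant (Q.preB_mem i p h)).choose_spec

end Torus

section Exponents

variable {I : Type*} [Fintype I] [DecidableEq I] (D : FiniteCartanDatum I)

/-- `β(i,p;j,s) = δ(i = j) (-δ(p - s = 1) + δ(p - s = -1)) (α_i, α_i)`. -/
def FiniteCartanDatum.betaExp (i : I) (p : ℤ) (j : I) (s : ℤ) : ℤ :=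
  (if i = j then 1 else 0) * (-(if p - s = 1 then 1 else 0) + (if p - s = -1 then 1 else 0)) *
    D.form (D.root i) (D.root i)

/-- `α(i,t;j,u)`, equal to `±(α_i, α_i)` if `(i,t) = (j,u ± 2)`, to `±2(α_i, α_j)` if `d(i,j) = 1`
and `t = u ± 1`, and to `0` otherwise. -/
def FiniteCartanDatum.alphaExp (i : I) (t : ℤ) (j : I) (u : ℤ) : ℤ :=
  if (i, t) = (j, u + 2) then D.form (D.root i) (D.root i)
  else if (i, t) = (j, u - 2) then -D.form (D.root i) (D.root i)
  else if D.dist i j = 1 ∧ t = u + 1 then 2 * D.form (D.root i) (D.root j)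
  else if D.dist i j = 1 ∧ t = u - 1 then -(2 * D.form (D.root i) (D.root j))
  else 0

end Exponents

end QVirtual

end

namespace QVirtual

open scoped LaurentPolynomial LaurentSeries RatFunc

/-! ### Recursions for the Laurent coefficients and the resulting sums of exponents -/

section CartanRecursion

variable {I : Type*} [Fintype I] [DecidableEq I] (D : FiniteCartanDatum I)

/-! The commutation exponent of two monomials is biadditive, and the central scalar in `B` does not
affect it, so both claims reduce to sums of the exponents `N`.

The arithmetic comes from `B(t)⁻¹ C(t) = diag(d)`. Comparing coefficients of `t^u` gives
`b_{ij}(u+1) + b_{ij}(u-1) + ∑_{k≠j} c_{kj} b_{ik}(u) = δ_{ij} δ_{u,0} d_i` for every integer `u`.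
Symmetrizing under `u ↦ -u` gives the same relation for `η`, with `2 d_i = (α_i, α_i)` on the right
(`eta_recursion`). The left side has the shape of the monomial `B_{j,s}`: two vertices at `s ± 1`,
and neighbours `k` at `s` with exponents `c_{kj}`. Since `N` is a difference of two values of `η`,
the exponent of `X_{i,p}` against `B_{j,s}` is a difference of two delta functions, namely `-β`
(`N_sum`).

Expanding `B_{i,t}` in the same way sums `β` over its factors (`betaExp_sum`). Only factors with
first index `j` survive: the two outer ones if `i = j`, the neighbour factor `X_{j,t}` if `i` and
`j` are adjacent. This leaves `-α`. -/

theorem FiniteCartanDatum.d_mul_C_symm (i j : I) : D.d i * D.C i j = D.d j * D.C j i := by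
  -- Positive definiteness includes hermitian symmetry, which over the integers is plain symmetry.
  have h := D.posDef.1.apply i j
  simpa [Matrix.diagonal_mul] using h.symm

theorem FiniteCartanDatum.dist_self (i : I) : D.dist i i = 0 := by
  simp [FiniteCartanDatum.dist]

theorem FiniteCartanDatum.dist_comm (i j : I) : D.dist i j = D.dist j i :=
  SimpleGraph.dist_comm

theorem FiniteCartanDatum.C_eq_zero {i j : I} (hij : i ≠ j) (h : D.dist i j ≠ 1) :
    D.C i j = 0 := by
  by_contra h0
  have hlt : D.C i j < 0 := lt_of_le_of_ne (D.offDiag i j hij) h0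
  apply h
  rw [FiniteCartanDatum.dist, SimpleGraph.dist_eq_one_iff_adj]
  exact ⟨hij, Or.inl hlt⟩

open Classical in
/-- A sum over the neighbours of `j`, weighted by Cartan integers, is a sum over all `k ≠ j`. -/
theorem FiniteCartanDatum.sum_neighbours (j : I) (f : I → ℤ) :
    ∑ k : {k : I // D.dist j k = 1}, D.C k.1 j * f k.1 =
      ∑ k ∈ Finset.univ.erase j, D.C k j * f k := by
  have h1 : ∑ k : {k : I // D.dist j k = 1}, D.C k.1 j * f k.1 =
      ∑ k ∈ Finset.univ.filter (fun k => D.dist j k = 1), D.C k j * f k :=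
    (Finset.sum_subtype _ (by simp) (fun k => D.C k j * f k)).symm
  rw [h1]
  refine Finset.sum_subset ?_ ?_
  · intro k hk
    rw [Finset.mem_filter] at hk
    refine Finset.mem_erase.2 ⟨?_, Finset.mem_univ _⟩
    rintro rfl
    rw [D.dist_self] at hk
    exact absurd hk.2 (by norm_num)
  · intro k hk hk'
    rw [D.C_eq_zero (Finset.ne_of_mem_erase hk) (fun h => hk' (by
      rw [Finset.mem_filter, D.dist_comm]; exact ⟨Finset.mem_univ _, h⟩)), zero_mul]

/-- Since `B(t)⁻¹ = t · diag(d) · (t C(t))⁻¹`, the coefficients can be computed from an inverse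
matrix over integral power series. -/
theorem FiniteCartanDatum.bCoeff_eq_coeff (i j : I) (u : ℤ) :
    (D.bCoeff i j u : ℚ) =
      (intToLaurent (PowerSeries.X * (PowerSeries.C (D.d i) * D.tCartanPow⁻¹ i j))).coeff u := by
  have h := congrFun (congrFun D.map_tB_inv i) j
  simp only [RingHom.mapMatrix_apply, Matrix.map_apply, Matrix.smul_apply, Matrix.diagonal_mul,
    smul_eq_mul] at h
  rw [D.cast_bCoeff, FiniteCartanDatum.bCoeffRat, h]

theorem intToLaurent_X : intToLaurent PowerSeries.X = (HahnSeries.single 1 1 : ℚ⸨X⸩) := by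
  simp [intToLaurent]

theorem intToLaurent_C (n : ℤ) :
    intToLaurent (PowerSeries.C n) = (HahnSeries.C (n : ℚ) : ℚ⸨X⸩) := by
  simp [intToLaurent]

theorem coeff_intToLaurent_X_mul (f : PowerSeries ℤ) (u : ℤ) :
    (intToLaurent (PowerSeries.X * f)).coeff u = (intToLaurent f).coeff (u - 1) := by
  rw [map_mul, intToLaurent_X]
  have h := HahnSeries.coeff_single_mul_add (r := (1 : ℚ)) (x := intToLaurent f) (a := u - 1)
    (b := (1 : ℤ))
  simpa using h

theorem coeff_intToLaurent_C_mul (n : ℤ) (f : PowerSeries ℤ) (u : ℤ) :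
    (intToLaurent (PowerSeries.C n * f)).coeff u = n * (intToLaurent f).coeff u := by
  rw [map_mul, intToLaurent_C, HahnSeries.C_mul_eq_smul]
  simp

/-- Column `j` of the identity `M · tC(t) = 1`, for the row `m` of a left inverse `M`. -/
theorem FiniteCartanDatum.row_mul_tCartanPow (m : I → PowerSeries ℤ) (j : I) :
    ∑ k, m k * D.tCartanPow k j = m j + PowerSeries.X * (PowerSeries.X * m j) +
      ∑ k ∈ Finset.univ.erase j, PowerSeries.X * (PowerSeries.C (D.C k j) * m k) := by
  rw [← Finset.add_sum_erase _ _ (Finset.mem_univ j)]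
  congr 1
  · rw [FiniteCartanDatum.tCartanPow, if_pos rfl]
    ring
  · refine Finset.sum_congr rfl fun k hk => ?_
    rw [FiniteCartanDatum.tCartanPow, if_neg (Finset.ne_of_mem_erase hk)]
    ring

theorem FiniteCartanDatum.inv_row_mul_tCartanPow (i j : I) :
    ∑ k, D.tCartanPow⁻¹ i k * D.tCartanPow k j = if i = j then 1 else 0 := by
  rw [← Matrix.mul_apply, Matrix.nonsing_inv_mul _ D.isUnit_det_tCartanPow, Matrix.one_apply]

/-- The comparison of coefficients of `t ^ (u + 1)` in `B(t)⁻¹ · t C(t) = t diag(d)`. -/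
theorem FiniteCartanDatum.bCoeff_recursion (i j : I) (u : ℤ) :
    D.bCoeff i j (u + 1) + D.bCoeff i j (u - 1) +
      ∑ k ∈ Finset.univ.erase j, D.C k j * D.bCoeff i k u =
    if i = j ∧ u = 0 then D.d i else 0 := by
  have hM := (D.row_mul_tCartanPow (D.tCartanPow⁻¹ i) j).symm.trans (D.inv_row_mul_tCartanPow i j)
  -- The shift by one is the factor `t` in `B(t)⁻¹ = t · diag(d) · (t C(t))⁻¹`.
  have hb : ∀ k v, (D.bCoeff i k (v + 1) : ℚ) =
      D.d i * (intToLaurent (D.tCartanPow⁻¹ i k)).coeff v := fun k v => by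
    rw [D.bCoeff_eq_coeff, coeff_intToLaurent_X_mul, coeff_intToLaurent_C_mul,
      add_sub_cancel_right]
  generalize D.tCartanPow⁻¹ i = m at hM hb
  -- Coefficient of `t^u` in the column identity. It holds for negative `u` as well, which the
  -- symmetrization to `η` needs.
  have hcoeff : (intToLaurent (m j)).coeff u + (intToLaurent (m j)).coeff (u - 1 - 1) +
      ∑ k ∈ Finset.univ.erase j, (D.C k j : ℚ) * (intToLaurent (m k)).coeff (u - 1) =
      if i = j ∧ u = 0 then 1 else 0 := by
    have h := congrArg (fun f => (intToLaurent f).coeff u) hM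
    simp only [map_add, map_sum, HahnSeries.coeff_add, HahnSeries.coeff_sum,
      coeff_intToLaurent_X_mul, coeff_intToLaurent_C_mul] at h
    rw [h]
    by_cases hij : i = j
    · simp [hij, HahnSeries.coeff_one]
    · simp [hij]
  have hb' : ∀ k v, (D.bCoeff i k v : ℚ) = D.d i * (intToLaurent (m k)).coeff (v - 1) :=
    fun k v => by rw [← hb, sub_add_cancel]
  have hrat : (D.bCoeff i j (u + 1) : ℚ) + D.bCoeff i j (u - 1) +
      ∑ k ∈ Finset.univ.erase j, (D.C k j : ℚ) * D.bCoeff i k u =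
      D.d i * if i = j ∧ u = 0 then 1 else 0 := by
    rw [← hcoeff, hb, hb', mul_add, mul_add, Finset.mul_sum]
    congr 1
    refine Finset.sum_congr rfl fun k _ => ?_
    rw [hb', mul_left_comm]
  rw [mul_ite, mul_one, mul_zero] at hrat
  exact_mod_cast hrat

/-- Add the recursion at `u` to the one at `-u`: the reflection swaps `u + 1` and `u - 1`, and both
delta terms sit at `u = 0`, whence the factor 2. -/
theorem FiniteCartanDatum.eta_recursion (i j : I) (u : ℤ) :
    D.eta i j (u + 1) + D.eta i j (u - 1) +
      ∑ k ∈ Finset.univ.erase j, D.C k j * D.eta i k u =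
    if i = j ∧ u = 0 then 2 * D.d i else 0 := by
  have h1 := D.bCoeff_recursion i j u
  have h2 := D.bCoeff_recursion i j (-u)
  simp only [FiniteCartanDatum.eta, mul_add, Finset.sum_add_distrib]
  rw [neg_add', neg_sub']
  simp only [neg_eq_zero, sub_neg_eq_add] at h1 h2 ⊢
  split_ifs at h1 h2 ⊢ <;> linarith

/-- The exponent with which `X_{i,p}` passes `B_{j,s}`. -/
theorem FiniteCartanDatum.N_sum (i j : I) (p s : ℤ) :
    D.N (i, p) (j, s - 1) + D.N (i, p) (j, s + 1) +
      ∑ k ∈ Finset.univ.erase j, D.C k j * D.N (i, p) (k, s) = -D.betaExp i p j s := by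
  have h1 := D.eta_recursion i j (p - s - 1)
  have h2 := D.eta_recursion i j (p - s + 1)
  have hβ : -D.betaExp i p j s = (if i = j ∧ p - s - 1 = 0 then 2 * D.d i else 0) -
      (if i = j ∧ p - s + 1 = 0 then 2 * D.d i else 0) := by
    rw [FiniteCartanDatum.betaExp, D.form_root_self]
    by_cases hij : i = j
    · simp only [hij, true_and, if_true]
      split_ifs <;> omega
    · simp [hij]
  rw [hβ, ← h1, ← h2]
  -- The sum of the `N` is the `η`-recursion at `p - s - 1` minus the one at `p - s + 1`; the two
  -- occurrences of `η_{ij}(p - s)` cancel.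
  simp only [FiniteCartanDatum.N, mul_sub, Finset.sum_sub_distrib]
  ring_nf

/-- The exponent with which `B_{i,t}` passes `B_{j,u}`. -/
theorem FiniteCartanDatum.betaExp_sum (i j : I) (t u : ℤ) :
    D.betaExp i (t - 1) j u + D.betaExp i (t + 1) j u +
      ∑ k ∈ Finset.univ.erase i, D.C k i * D.betaExp k t j u = -D.alphaExp i t j u := by
  by_cases hij : i = j
  · subst hij
    -- Neighbour factors have first index different from `j`. The two outer factors cancel at `t =
    -- u` and leave `t = u ± 2`.
    rw [Finset.sum_eq_zero]
    · rw [FiniteCartanDatum.alphaExp, D.dist_self]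
      simp only [FiniteCartanDatum.betaExp, Prod.mk.injEq, true_and, if_true, zero_ne_one,
        false_and, if_false]
      split_ifs <;> omega
    · intro k hk
      rw [FiniteCartanDatum.betaExp, if_neg (Finset.ne_of_mem_erase hk)]
      ring
  -- Only `X_{j,t}`, with exponent `c_{ji}`, can contribute. The resulting `2 d_j c_{ji}` equals `2
  -- (α_i, α_j)` by symmetry of the form.
  · rw [Finset.sum_eq_single_of_mem j (Finset.mem_erase.2 ⟨Ne.symm hij, Finset.mem_univ _⟩)]
    · have hsymm := D.d_mul_C_symm i j
      rw [FiniteCartanDatum.alphaExp, D.form_root i j]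
      simp only [FiniteCartanDatum.betaExp, Prod.mk.injEq, hij, false_and, if_false, if_true,
        D.form_root_self]
      by_cases hd : D.dist i j = 1
      · simp only [hd, true_and]
        split_ifs <;> first | omega | linarith
      · rw [D.C_eq_zero (Ne.symm hij) (by rwa [D.dist_comm])]
        simp [hd]
    · intro k _ hk
      rw [FiniteCartanDatum.betaExp, if_neg hk]
      ring

end CartanRecursion

/-! ### Calculus of commutation up to powers of `q` -/

section QCommutation

variable {I : Type*} [Fintype I] [DecidableEq I] {D : FiniteCartanDatum I} (Q : DynkinQuiver D)

/-- The units `x` and `y` commute up to the factor `q^k`. -/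
def DynkinQuiver.QComm (x y : Q.Torusˣ) (k : ℤ) : Prop :=
  x * y = Q.qHalf (2 * k) * (y * x)

variable {Q}

namespace DynkinQuiver.QComm

variable {x y z : Q.Torusˣ} {k l : ℤ}

theorem symm (h : Q.QComm x y k) : Q.QComm y x (-k) := by
  rw [DynkinQuiver.QComm, mul_neg, Q.qHalf_neg, eq_inv_mul_iff_mul_eq]
  exact Eq.symm h

/-- Centrality of `q^{1/2}`: this is why the bar-invariant normalization of `B` plays no role. -/
theorem qHalf_right (x : Q.Torusˣ) (n : ℤ) : Q.QComm x (Q.qHalf n) 0 := by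
  rw [DynkinQuiver.QComm, mul_zero, Q.qHalf_zero, one_mul, Q.qHalf_comm]

theorem mul_right (h : Q.QComm x y k) (h' : Q.QComm x z l) : Q.QComm x (y * z) (k + l) := by
  unfold DynkinQuiver.QComm at *
  rw [← mul_assoc, h, mul_assoc, mul_assoc y, h', ← mul_assoc y, ← Q.qHalf_comm, mul_add,
    Q.qHalf_add]
  simp only [mul_assoc]

theorem one_right (x : Q.Torusˣ) : Q.QComm x 1 0 := by
  simpa [Q.qHalf_zero] using qHalf_right x 0

theorem inv_right (h : Q.QComm x y k) : Q.QComm x y⁻¹ (-k) := by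
  unfold DynkinQuiver.QComm at *
  rw [mul_neg, Q.qHalf_neg, eq_inv_mul_iff_mul_eq, eq_inv_mul_iff_mul_eq, ← mul_assoc, ← mul_assoc,
    ← Q.qHalf_comm, mul_assoc (Q.qHalf _), ← h, mul_inv_cancel_right]

theorem inv_left (h : Q.QComm x y k) : Q.QComm x⁻¹ y (-k) := by
  simpa using h.symm.inv_right.symm

theorem pow_right (h : Q.QComm x y k) (n : ℕ) : Q.QComm x (y ^ n) (n * k) := by
  induction n with
  | zero => simpa using one_right x
  | succ n ih => simpa [pow_succ, add_mul] using ih.mul_right h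

theorem zpow_right (h : Q.QComm x y k) (n : ℤ) : Q.QComm x (y ^ n) (n * k) := by
  obtain ⟨m, rfl | rfl⟩ := n.eq_nat_or_neg
  · simpa using h.pow_right m
  · simpa using (h.pow_right m).inv_right

theorem noncommProd_right {ι : Type*} (s : Finset ι) (f : ι → Q.Torusˣ)
    (comm : (s : Set ι).Pairwise (Function.onFun Commute f)) (e : ι → ℤ)
    (h : ∀ a ∈ s, Q.QComm x (f a) (e a)) :
    Q.QComm x (s.noncommProd f comm) (∑ a ∈ s, e a) := by
  classical
  induction s using Finset.induction_on with
  | empty => simpa using one_right x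
  | insert a s ha ih =>
    rw [Finset.noncommProd_insert_of_notMem _ _ _ _ ha, Finset.sum_insert ha]
    exact (h a (Finset.mem_insert_self a s)).mul_right
      (ih _ fun b hb => h b (Finset.mem_insert_of_mem hb))

theorem coe_mul (h : Q.QComm x y k) :
    (x * y : Q.Torus) = qPow k • (y * x : Q.Torus) := by
  have h' := congrArg Units.val h
  rw [Units.val_mul, Units.val_mul, Units.val_mul, Q.coe_qHalf] at h'
  rw [h', Algebra.smul_def, qPow]

/-- If `x` commutes with each `X_v` up to `q^{e v}`, it commutes with `B_{i,p}` up to a power of `q`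
computed from the exponents of the monomial `B_{i,p}`. -/
theorem B_right {x : Q.Torusˣ} (e : I × ℤ → ℤ) (i : I) (p : ℤ) (hp : (i, p + 1) ∈ Q.vertices)
    (h : ∀ v : Q.vertices, Q.QComm x (Q.X v) (e v)) :
    Q.QComm x (Q.B i p hp) (e (i, p - 1) + e (i, p + 1) +
      ∑ k ∈ Finset.univ.erase i, D.C k i * e (k, p)) := by
  classical
  have hprod := noncommProd_right Finset.univ
    (fun j : {j : I // D.dist i j = 1} => Q.X ⟨(j.1, p), Q.mem_adj hp j.2⟩ ^ D.C j.1 i)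
    (fun _ _ _ _ _ => (Q.commute_same_level _ _ _ _ _).zpow_zpow _ _)
    (fun j => D.C j.1 i * e (j.1, p)) (fun j _ => (h ⟨(j.1, p), Q.mem_adj hp j.2⟩).zpow_right _)
  have hB := (qHalf_right x (Q.exists_barInvariant (Q.preB_mem i p hp)).choose).mul_right
    (((h ⟨(i, p - 1), Q.mem_sub_one hp⟩).mul_right (h ⟨(i, p + 1), hp⟩)).mul_right hprod)
  -- The product in `B` runs over neighbours only; the other `c_{ki}` with `k ≠ i` vanish.
  rw [← D.sum_neighbours i (fun k => e (k, p))]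
  rw [zero_add] at hB
  exact hB

end DynkinQuiver.QComm

theorem DynkinQuiver.X_qComm_B (v : Q.vertices) (j : I) (s : ℤ) (hs : (j, s + 1) ∈ Q.vertices) :
    Q.QComm (Q.X v) (Q.B j s hs) (-D.betaExp v.1.1 v.1.2 j s) := by
  rw [← D.N_sum]
  exact DynkinQuiver.QComm.B_right (fun w => D.N v w) j s hs fun w => Q.X_mul_X' v w

theorem DynkinQuiver.B_qComm_B (i j : I) (t u : ℤ) (ht : (i, t + 1) ∈ Q.vertices)
    (hu : (j, u + 1) ∈ Q.vertices) :
    Q.QComm (Q.B i t ht) (Q.B j u hu) (D.alphaExp i t j u) := by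
  -- `B_right` expands the right-hand factor, so `B_{i,t}` is placed there and the pair is swapped
  -- back at the end.
  have h := DynkinQuiver.QComm.B_right (x := Q.B j u hu)
    (fun w => D.betaExp w.1 w.2 j u) i t ht fun w => by
      simpa using (DynkinQuiver.X_qComm_B w j u hu).symm
  rw [D.betaExp_sum] at h
  simpa using h.symm

end QCommutation

end QVirtual

theorem mainTheorem8 {I : Type*} [Fintype I] [DecidableEq I]
    (D : QVirtual.FiniteCartanDatum I) (Q : QVirtual.DynkinQuiver D) :
    (∀ (i j : I) (p s : ℤ) (hp : (i, p) ∈ Q.vertices) (hs : (j, s + 1) ∈ Q.vertices),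
      (Q.X ⟨(i, p), hp⟩ : Q.Torus) * ((Q.B j s hs)⁻¹ : Q.Torusˣ) =
        QVirtual.qPow (D.betaExp i p j s) •
          (((Q.B j s hs)⁻¹ : Q.Torusˣ) * (Q.X ⟨(i, p), hp⟩ : Q.Torus) : Q.Torus)) ∧
    (∀ (i j : I) (t u : ℤ) (ht : (i, t + 1) ∈ Q.vertices) (hu : (j, u + 1) ∈ Q.vertices),
      (((Q.B i t ht)⁻¹ : Q.Torusˣ) * ((Q.B j u hu)⁻¹ : Q.Torusˣ) : Q.Torus) =
        QVirtual.qPow (D.alphaExp i t j u) •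
          (((Q.B j u hu)⁻¹ : Q.Torusˣ) * ((Q.B i t ht)⁻¹ : Q.Torusˣ) : Q.Torus)) := by
  refine ⟨fun i j p s hp hs => ?_, fun i j t u ht hu => ?_⟩
  -- Inverting `B` turns the exponent `-β` into `β`; in the second claim the two inversions cancel.
  · simpa using (QVirtual.DynkinQuiver.X_qComm_B ⟨(i, p), hp⟩ j s hs).inv_right.coe_mul
  · simpa using (QVirtual.DynkinQuiver.B_qComm_B i j t u ht hu).inv_left.inv_right.coe_mul
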